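/- Let $(W,S)$ be a Coxeter system with $S$ finite, with length function $\ell$. Let $V$ be the real vector space with basis $\{\alpha_s \mid s\in S\}$ and symmetric bilinear form $\langle\alpha_s,\alpha_t\rangle=-\cos(\pi/m(s,t))$ (equal to $-1$ when $m(s,t)=\infty$), on which $W$ acts by $s v=v-2\langle v,\alpha_s\rangle\alpha_s$. For $w\in W$ let $\Phi^R(w)=\{-w\alpha_s\mid s\in S,\ \ell(ws)=\ell(w)-1\}$ be the set of right-descent roots of $w$, and let $T(w)=\{v\in W\mid \ell(wv)=\ell(w)+\ell(v)\}$ be the cone type of $w$. The cone type partition of $W$ is the partition into the sets $Q(T)=\{x\in W\mid T(x^{-1})=T\}$, where $T$ ranges over the cone types. Each part $Q(T)$ has a unique element of minimal length, called its gate; let $\Gamma$ be the set of gates. Let $\preceq$ be the right weak order, $x\preceq y$ if and only if $\ell(y)=\ell(x)+\ell(x^{-1}y)$. An element $x$ of a poset $P$ is join-irreducible if it is not the minimal element of $P$ and, whenever $x=a\vee b$ in $P$ with $a,b\in P$, either $x=a$ or $x=b$. **Theorem.** The set of tight gates $$\Gamma^0=\{g\in\Gamma \mid |\Phi^R(g)|=1\}$$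 is exactly the set of join-irreducible elements of the partially ordered set $(\Gamma,\preceq)$. -/

import Mathlib

open Real

/-! ### The standard geometric representation and the root system -/

namespace CoxeterMatrix

variable {B : Type*} (M : CoxeterMatrix B)

/-- The simple root `α_i`, the `i`-th basis vector of the real vector space with basis `B`. -/
noncomputable def simpleRoot (_M : CoxeterMatrix B) (i : B) : B →₀ ℝ := Finsupp.single i 1

/-- The bilinear form with `⟨α_i, α_j⟩ = -cos (π / m(i, j))`. An infinite label is encoded in
Mathlib as `M i j = 0`, and then the value is `-cos 0 = -1`, as it should be. -/
noncomputable def rootForm : (B →₀ ℝ) →ₗ[ℝ] (B →₀ ℝ) →ₗ[ℝ] ℝ :=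
  Finsupp.linearCombination ℝ fun i =>
    Finsupp.linearCombination ℝ fun j => -Real.cos (π / (M i j : ℝ))

theorem rootForm_simpleRoot (i j : B) :
    M.rootForm (M.simpleRoot i) (M.simpleRoot j) = -Real.cos (π / (M i j : ℝ)) := by
  simp [rootForm, simpleRoot]

theorem two_smul_rootForm_self (i : B) :
    ((2 : ℝ) • M.rootForm.flip (M.simpleRoot i)) (M.simpleRoot i) = 2 := by
  simp [rootForm_simpleRoot]

/-- The reflection `v ↦ v - 2 ⟨v, α_i⟩ α_i`. -/
noncomputable def simpleReflection (i : B) : (B →₀ ℝ) ≃ₗ[ℝ] (B →₀ ℝ) :=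
  Module.reflection (M.two_smul_rootForm_self i)

theorem simpleReflection_apply (i : B) (v : B →₀ ℝ) :
    M.simpleReflection i v = v - (2 * M.rootForm v (M.simpleRoot i)) • M.simpleRoot i := by
  simp [simpleReflection, Module.reflection_apply]

open Polynomial.Chebyshev in
/-- The reflections satisfy the defining relations of the Coxeter group. -/
theorem simpleReflection_isLiftable : M.IsLiftable M.simpleReflection := by
  intro i j
  rcases eq_or_ne i j with rfl | hij
  · rw [M.diagonal, pow_one]
    ext1 v
    exact Module.involutive_reflection (M.two_smul_rootForm_self i) v
  set m := M i j with hm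
  have hm1 : m ≠ 1 := M.off_diagonal i j hij
  rcases Nat.eq_zero_or_pos m with h0 | hpos
  · rw [h0, pow_zero]
  have hmR : (m : ℝ) ≠ 0 := by positivity
  have hc1 : ((2 : ℝ) • M.rootForm.flip (M.simpleRoot i)) (M.simpleRoot j) =
      -2 * Real.cos (π / m) := by
    simp [rootForm_simpleRoot, M.symmetric j i, ← hm]
  have hc2 : ((2 : ℝ) • M.rootForm.flip (M.simpleRoot j)) (M.simpleRoot i) =
      -2 * Real.cos (π / m) := by
    simp [rootForm_simpleRoot, ← hm]
  have ht : 2 * Real.cos (2 * (π / m)) =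
      ((2 : ℝ) • M.rootForm.flip (M.simpleRoot i)) (M.simpleRoot j) *
        ((2 : ℝ) • M.rootForm.flip (M.simpleRoot j)) (M.simpleRoot i) - 2 := by
    rw [hc1, hc2, Real.cos_two_mul]; ring
  ext1 v
  refine (Module.reflection_mul_reflection_pow_apply (M.two_smul_rootForm_self i)
    (M.two_smul_rootForm_self j) m v (2 * Real.cos (2 * (π / m))) ht).trans ?_
  rw [LinearEquiv.coe_one, id_eq, hc1, hc2]
  rcases eq_or_ne m 2 with h2 | h2
  · rw [h2]
    have e1 : Real.cos (2 * (π / ((2 : ℕ) : ℝ))) = -1 := by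
      rw [show 2 * (π / ((2 : ℕ) : ℝ)) = π by push_cast; ring, Real.cos_pi]
    have e2 : Real.cos (π / ((2 : ℕ) : ℝ)) = 0 := by
      push_cast; exact Real.cos_pi_div_two
    rw [e1, e2]
    norm_num
    module
  have hm3 : 3 ≤ m := by omega
  have hsin : Real.sin (2 * (π / m)) ≠ 0 := by
    apply ne_of_gt
    apply Real.sin_pos_of_pos_of_lt_pi
    · positivity
    · rw [show 2 * (π / m) = π * (2 / m) by ring]
      have : (2 : ℝ) / m < 1 := by
        rw [div_lt_one (by positivity)]; exact_mod_cast hm3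
      nlinarith [Real.pi_pos]
  rcases Nat.even_or_odd' m with ⟨k, hk | hk⟩
  · have z : (S ℝ ((k : ℤ) - 1)).eval (2 * Real.cos (2 * (π / m))) = 0 := by
      apply (mul_eq_zero.mp ?_).resolve_right hsin
      rw [S_two_mul_real_cos]
      have : (((k : ℤ) - 1 : ℤ) + 1 : ℝ) * (2 * (π / m)) = π := by
        have : (m : ℝ) = 2 * k := by exact_mod_cast hk
        push_cast
        field_simp
        linarith
      rw [this, Real.sin_pi]
    rw [show ((m : ℤ) - 2) / 2 = k - 1 by omega, show ((m : ℤ) - 1) / 2 = k - 1 by omega, z]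
    simp
  · have z : (S ℝ (k : ℤ)).eval (2 * Real.cos (2 * (π / m))) +
        (S ℝ ((k : ℤ) - 1)).eval (2 * Real.cos (2 * (π / m))) = 0 := by
      apply (mul_eq_zero.mp ?_).resolve_right hsin
      rw [add_mul, S_two_mul_real_cos, S_two_mul_real_cos]
      have hmk : (m : ℝ) = 2 * k + 1 := by exact_mod_cast hk
      have e1 : (((k : ℤ) : ℝ) + 1) * (2 * (π / m)) = π + π / m := by
        push_cast
        field_simp
        linarith
      have e2 : (((k : ℤ) - 1 : ℤ) + 1 : ℝ) * (2 * (π / m)) = π - π / m := by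
        push_cast
        field_simp
        linarith
      rw [e1, e2, Real.sin_pi_sub, add_comm π, Real.sin_add_pi]
      ring
    rw [show ((m : ℤ) - 2) / 2 = k - 1 by omega, show ((m : ℤ) - 1) / 2 = k by omega,
      show ((m : ℤ) - 3) / 2 = k - 1 by omega, show (m : ℤ) / 2 = k by omega, z]
    simp

end CoxeterMatrix

namespace CoxeterSystem

variable {B W : Type*} [Group W] {M : CoxeterMatrix B} (cs : CoxeterSystem M W)

/-- The linear action of `W` in which `s_i` acts by `v ↦ v - 2 ⟨v, α_i⟩ α_i`. -/
noncomputable def rootAction : W →* ((B →₀ ℝ) ≃ₗ[ℝ] (B →₀ ℝ)) :=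
  cs.lift ⟨M.simpleReflection, M.simpleReflection_isLiftable⟩

theorem rootAction_simple (i : B) : cs.rootAction (cs.simple i) = M.simpleReflection i :=
  cs.lift_apply_simple M.simpleReflection_isLiftable i

/-- The set `Φ^R(w) = {-w α_s | s ∈ D_R(w)}` of right-descent roots of `w`. -/
def rightDescentRoots (w : W) : Set (B →₀ ℝ) :=
  {β | ∃ i, cs.IsRightDescent w i ∧ β = -cs.rootAction w (M.simpleRoot i)}

/-! ### Cone types and gates -/

/-- The cone type `T(w) = {v | ℓ(w v) = ℓ(w) + ℓ(v)}`. -/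
def coneType (w : W) : Set W :=
  {v | cs.length (w * v) = cs.length w + cs.length v}

/-- The set of all cone types of `W`. -/
def coneTypes : Set (Set W) := Set.range cs.coneType

/-- The part `Q(T) = {x | T(x⁻¹) = T}` of the cone type partition. -/
def coneTypePart (T : Set W) : Set W := {x | cs.coneType x⁻¹ = T}

/-- The set `Γ` of gates of the cone type partition: the elements that have minimal length in
their part. -/
def gates : Set W :=
  {g | ∃ T ∈ cs.coneTypes, g ∈ cs.coneTypePart T ∧
    ∀ x ∈ cs.coneTypePart T, cs.length g ≤ cs.length x}

/-- The set `Γ⁰` of tight gates: the gates with exactly one right-descent root. -/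
def tightGates : Set W := {g | g ∈ cs.gates ∧ (cs.rightDescentRoots g).ncard = 1}

/-! ### The right weak order -/

/-- The right weak order: `x ⪯ y` if and only if `ℓ(y) = ℓ(x) + ℓ(x⁻¹ y)`. -/
@[reducible] def rightWeakOrder : PartialOrder W where
  le x y := cs.length y = cs.length x + cs.length (x⁻¹ * y)
  le_refl x := by simp
  le_trans x y z hxy hyz := by
    have h1 := cs.length_mul_le x (x⁻¹ * z)
    have h2 := cs.length_mul_le (x⁻¹ * y) (y⁻¹ * z)
    rw [mul_inv_cancel_left] at h1
    rw [mul_assoc, mul_inv_cancel_left] at h2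
    change cs.length y = _ at hxy
    change cs.length z = _ at hyz
    change cs.length z = _
    omega
  le_antisymm x y hxy hyx := by
    change cs.length y = _ at hxy
    change cs.length x = _ at hyx
    have h : cs.length (x⁻¹ * y) = 0 := by omega
    rw [cs.length_eq_zero_iff, inv_mul_eq_one] at h
    exact h

/-- The poset `(Γ, ⪯)`: the gates with the order induced by the right weak order. -/
instance gatesPartialOrder : PartialOrder cs.gates :=
  @Subtype.partialOrder W cs.rightWeakOrder (fun g => g ∈ cs.gates)

end CoxeterSystem

/-- An element `x` of a poset is join-irreducible if it is not minimal and whenever `x` is the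
join of `a` and `b` in the poset, then `x = a` or `x = b`. -/
def IsJoinIrreducible {P : Type*} [PartialOrder P] (x : P) : Prop :=
  ¬IsMin x ∧ ∀ a b : P, IsLUB {a, b} x → x = a ∨ x = b

namespace CoxeterSystem

variable {B W : Type*} [Group W] {M : CoxeterMatrix B} (cs : CoxeterSystem M W)

/-! ### The exchange condition -/

/-! Write x ⊥ v (`Perp x v`) for v ∈ T(x⁻¹); the part of x is determined by the set of v with x ⊥ v.
This set shrinks as x grows in the weak order, and `IsWeakJoin.perp` says that a join of elements
corresponds to the intersection of the sets. By `IsWeakMeet.perp` parts are closed under meets, so a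
gate is the weak-order minimum of its part.

If a gate g has two right descents s ≠ t, then g = gs ∨ gt. Replacing gs and gt by the gates a and b
of their parts changes no cone type, so a ∨ b ⪯ g lies in the part of g. Minimality gives g = a ∨ b
with a, b ≠ g, and g is reducible.

If s is the only right descent of g, every gate strictly below g is below gs, hence by `gate_weakLE`
below the gate c of the part of gs. So c is the largest gate strictly below g, and g is no join of
smaller gates.

The crux `gate_weakLE` is an induction down right descents. Where two chains leave x by different
descents r and q, `exists_weakLE_perp_of_isRightDescent` applies: if x and xr have the same cone
type, so do xq and the bottom of the {r, q}-residue of x. A gate below xq thus drops to that bottom,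
which is below xr.

The weak-order facts all rest on the exchange condition, proved by counting inversions mod 2. -/

open Classical in
/-- Conjugation by a simple reflection, recording in the second component whether the conjugated
element is the simple reflection itself. -/
noncomputable def signedConj (i : B) (p : W × ZMod 2) : W × ZMod 2 :=
  (cs.simple i * p.1 * cs.simple i, p.2 + if p.1 = cs.simple i then 1 else 0)

theorem signedConj_involutive (i : B) : Function.Involutive (cs.signedConj i) := by
  rintro ⟨t, ε⟩
  have h : cs.simple i * t * cs.simple i = cs.simple i ↔ t = cs.simple i := by
    constructor
    · intro h
      have := congrArg (fun x => cs.simple i * x * cs.simple i) h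
      simpa [mul_assoc] using this
    · rintro rfl; simp
  ext
  · simp [signedConj, mul_assoc]
  · by_cases ht : t = cs.simple i
    · simp [signedConj, ht, add_assoc, CharTwo.add_self_eq_zero]
    · simp [signedConj, h, ht]

/-- The permutation of `W × ZMod 2` attached to a simple reflection. -/
noncomputable def signedConjPerm (i : B) : Equiv.Perm (W × ZMod 2) :=
  (cs.signedConj_involutive i).toPerm

theorem inv_pow_mul_simple (i j : B) (n : ℕ) :
    ((cs.simple i * cs.simple j) ^ n)⁻¹ * cs.simple j =
      cs.simple j * (cs.simple i * cs.simple j) ^ n := by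
  induction n with
  | zero => simp
  | succ n ih =>
    rw [pow_succ, mul_inv_rev, mul_assoc, ih, ← pow_succ, pow_succ']
    simp [mul_assoc]

-- The second component counts, mod 2, the occurrences of `t` among the 2n reflections met in
-- succession when conjugating by the alternating word.
open Classical in
theorem signedConjPerm_pow_apply (i j : B) (n : ℕ) (t : W) (ε : ZMod 2) :
    ((cs.signedConjPerm i * cs.signedConjPerm j) ^ n) (t, ε) =
      ((cs.simple i * cs.simple j) ^ n * t * ((cs.simple i * cs.simple j) ^ n)⁻¹,
        ε + ∑ l ∈ Finset.range (2 * n),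
          if t = cs.simple j * (cs.simple i * cs.simple j) ^ l then 1 else 0) := by
  induction n with
  | zero => simp
  | succ n ih =>
    rw [pow_succ', Equiv.Perm.mul_apply, ih]
    set c := cs.simple i * cs.simple j with hc
    have h1 : c ^ n * t * (c ^ n)⁻¹ = cs.simple j ↔ t = cs.simple j * c ^ (2 * n) := by
      rw [two_mul, pow_add, ← mul_assoc, ← cs.inv_pow_mul_simple i j n, ← hc,
        mul_inv_eq_iff_eq_mul, mul_assoc, eq_inv_mul_iff_mul_eq]
    have h2 : cs.simple j * (c ^ n * t * (c ^ n)⁻¹) * cs.simple j = cs.simple i ↔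
        t = cs.simple j * c ^ (2 * n + 1) := by
      have key : cs.simple j * c ^ (2 * n + 1) = (c ^ n)⁻¹ * (cs.simple j * c) * c ^ n := by
        rw [← mul_assoc, hc, cs.inv_pow_mul_simple i j n, ← hc, mul_assoc, mul_assoc,
          ← pow_succ', ← pow_add]
        congr 2; ring
      have hjc : cs.simple j * c = cs.simple j * cs.simple i * cs.simple j := by
        rw [hc, mul_assoc]
      rw [key, hjc]
      constructor
      · intro h
        rw [← h]
        simp [mul_assoc]
      · intro h
        rw [h]
        simp [mul_assoc]
    simp only [Equiv.Perm.mul_apply, signedConjPerm, Function.Involutive.coe_toPerm, signedConj,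
      h1, h2]
    rw [show 2 * (n + 1) = 2 * n + 1 + 1 by ring, Finset.sum_range_succ, Finset.sum_range_succ]
    ext
    · simp [pow_succ', hc, mul_assoc]
    · simp only [add_assoc]

/-- For n = m(i, j) the list of 2m reflections runs twice through the same m entries, so every count
is even. -/
theorem signedConjPerm_isLiftable : M.IsLiftable cs.signedConjPerm := by
  classical
  intro i j
  ext1 ⟨t, ε⟩
  rw [signedConjPerm_pow_apply, two_mul, Finset.sum_range_add]
  simp [pow_add, CharTwo.add_self_eq_zero]

/-- The action of `W` on `W × ZMod 2` extending `signedConjPerm`. -/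
noncomputable def signedConjHom : W →* Equiv.Perm (W × ZMod 2) :=
  cs.lift ⟨cs.signedConjPerm, cs.signedConjPerm_isLiftable⟩

theorem signedConjHom_simple (i : B) : cs.signedConjHom (cs.simple i) = cs.signedConjPerm i :=
  cs.lift_apply_simple cs.signedConjPerm_isLiftable i

theorem signedConjHom_apply (w t : W) (ε : ZMod 2) :
    cs.signedConjHom w (t, ε) = (w * t * w⁻¹, ε + (cs.signedConjHom w (t, 0)).2) := by
  induction w using cs.simple_induction_left generalizing t ε with
  | one => simp
  | mul_simple_left w i ih =>
    rw [map_mul, Equiv.Perm.mul_apply, Equiv.Perm.mul_apply, ih, signedConjHom_simple]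
    conv_rhs => rw [ih]
    ext
    · simp [signedConjPerm, signedConj, mul_assoc]
    · simp [signedConjPerm, signedConj, add_assoc]

/-- The parity of the number of times that `t` occurs in the left inversion sequence of a word
for `w`. -/
noncomputable def inversionParity (w t : W) : ZMod 2 := (cs.signedConjHom w⁻¹ (t, 0)).2

theorem inversionParity_one (t : W) : cs.inversionParity 1 t = 0 := by
  simp [inversionParity]

open Classical in
theorem inversionParity_simple (i : B) (t : W) :
    cs.inversionParity (cs.simple i) t = if t = cs.simple i then 1 else 0 := by
  simp [inversionParity, signedConjHom_simple, signedConjPerm, signedConj]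

/-- The cocycle identity that makes the parity depend on the group element only, while being
computable from any word. -/
theorem inversionParity_mul (v w t : W) :
    cs.inversionParity (v * w) t =
      cs.inversionParity v t + cs.inversionParity w (v⁻¹ * t * v) := by
  simp only [inversionParity, mul_inv_rev, map_mul, Equiv.Perm.mul_apply]
  rw [cs.signedConjHom_apply v⁻¹ t 0, cs.signedConjHom_apply w⁻¹]
  simp

theorem mem_leftInvSeq_of_inversionParity_ne_zero {ω : List B} {t : W}
    (h : cs.inversionParity (cs.wordProd ω) t ≠ 0) : t ∈ cs.leftInvSeq ω := by
  classical
  induction ω generalizing t with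
  | nil => simp [inversionParity_one] at h
  | cons i ω ih =>
    rw [wordProd_cons, inversionParity_mul, inversionParity_simple] at h
    by_cases ht : t = cs.simple i
    · simp [leftInvSeq, ht]
    · rw [if_neg ht, zero_add] at h
      have := ih h
      simp only [leftInvSeq, List.mem_cons, List.mem_map]
      exact Or.inr ⟨_, this, by simp [mul_assoc]⟩

theorem exists_eraseIdx_of_inversionParity_ne_zero {ω : List B} {t : W}
    (h : cs.inversionParity (cs.wordProd ω) t ≠ 0) :
    ∃ j < ω.length, t * cs.wordProd ω = cs.wordProd (ω.eraseIdx j) := by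
  obtain ⟨j, hj, rfl⟩ := List.mem_iff_getElem.1 (cs.mem_leftInvSeq_of_inversionParity_ne_zero h)
  refine ⟨j, by simpa using hj, ?_⟩
  rw [← cs.getD_leftInvSeq_mul_wordProd, List.getD_eq_getElem _ _ hj]

theorem length_mul_lt_of_inversionParity_ne_zero {w t : W} (h : cs.inversionParity w t ≠ 0) :
    cs.length (t * w) < cs.length w := by
  obtain ⟨ω, hω, rfl⟩ := cs.exists_isReduced w
  obtain ⟨j, hj, e⟩ := cs.exists_eraseIdx_of_inversionParity_ne_zero h
  rw [e, hω.eq]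
  have := cs.length_wordProd_le (ω.eraseIdx j)
  rw [List.length_eraseIdx_of_lt hj] at this
  omega

/-- For the converse: if the parity at `s_i` vanishes for `w`, it is 1 for `s_i w`, so multiplying
by `s_i` shortens `s_i w` back to `w`. -/
theorem inversionParity_simple_ne_zero_iff {w : W} {i : B} :
    cs.inversionParity w (cs.simple i) ≠ 0 ↔ cs.IsLeftDescent w i := by
  refine ⟨cs.length_mul_lt_of_inversionParity_ne_zero, fun h h0 => ?_⟩
  have h1 : cs.inversionParity (cs.simple i * w) (cs.simple i) ≠ 0 := by
    classical
    rw [inversionParity_mul, inversionParity_simple]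
    simp [h0]
  have := cs.length_mul_lt_of_inversionParity_ne_zero h1
  rw [simple_mul_simple_cancel_left] at this
  exact absurd h (not_lt.2 this.le)

/-- The exchange condition. -/
theorem exists_eraseIdx_of_isLeftDescent {ω : List B} {i : B}
    (h : cs.IsLeftDescent (cs.wordProd ω) i) :
    ∃ j < ω.length, cs.simple i * cs.wordProd ω = cs.wordProd (ω.eraseIdx j) :=
  cs.exists_eraseIdx_of_inversionParity_ne_zero (cs.inversionParity_simple_ne_zero_iff.2 h)

/-- The folding condition. -/
theorem simple_mul_eq_mul_simple {y : W} {i j : B} (h : ¬cs.IsLeftDescent y i)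
    (h' : cs.IsLeftDescent (y * cs.simple j) i) : cs.simple i * y = y * cs.simple j := by
  classical
  rw [← inversionParity_simple_ne_zero_iff] at h h'
  rw [inversionParity_mul, not_not.1 h, zero_add, inversionParity_simple] at h'
  have : y⁻¹ * cs.simple i * y = cs.simple j := by
    by_contra hne
    simp [hne] at h'
  rw [← this]
  group

/-! ### The right weak order -/

/-- `x` is below `y` in the right weak order. -/
def WeakLE (x y : W) : Prop := cs.length y = cs.length x + cs.length (x⁻¹ * y)

variable {cs}

theorem WeakLE.refl (x : W) : cs.WeakLE x x := cs.rightWeakOrder.le_refl x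

theorem WeakLE.trans {x y z : W} (h : cs.WeakLE x y) (h' : cs.WeakLE y z) : cs.WeakLE x z :=
  cs.rightWeakOrder.le_trans x y z h h'

theorem WeakLE.antisymm {x y : W} (h : cs.WeakLE x y) (h' : cs.WeakLE y x) : x = y :=
  cs.rightWeakOrder.le_antisymm x y h h'

theorem WeakLE.length_le {x y : W} (h : cs.WeakLE x y) : cs.length x ≤ cs.length y := by
  rw [WeakLE] at h
  omega

theorem WeakLE.eq_of_length_le {x y : W} (h : cs.WeakLE x y)
    (h' : cs.length y ≤ cs.length x) : x = y := by
  rw [WeakLE] at h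
  rw [← inv_mul_eq_one, ← cs.length_eq_zero_iff]
  omega

variable (cs)

theorem one_weakLE (x : W) : cs.WeakLE 1 x := by simp [WeakLE]

theorem weakLE_mul_iff {x z : W} :
    cs.WeakLE x (x * z) ↔ cs.length (x * z) = cs.length x + cs.length z := by
  simp [WeakLE]

theorem simple_weakLE_iff {i : B} {x : W} : cs.WeakLE (cs.simple i) x ↔ cs.IsLeftDescent x i := by
  rw [isLeftDescent_iff, WeakLE, length_simple, inv_simple]
  omega

theorem mul_simple_weakLE_iff {x : W} {i : B} :
    cs.WeakLE (x * cs.simple i) x ↔ cs.IsRightDescent x i := by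
  rw [isRightDescent_iff, WeakLE]
  simp only [mul_inv_rev, inv_simple, inv_mul_cancel_right, length_simple]
  omega

theorem simple_mul_weakLE_simple_mul {x y : W} {i : B} (hx : ¬cs.IsLeftDescent x i)
    (h : cs.WeakLE x y) (hy : ¬cs.IsLeftDescent y i) :
    cs.WeakLE (cs.simple i * x) (cs.simple i * y) := by
  rw [not_isLeftDescent_iff] at hx hy
  rw [WeakLE] at h ⊢
  rw [hx, hy, mul_inv_rev, inv_simple, mul_assoc, simple_mul_simple_cancel_left]
  omega

theorem weakLE_of_simple_mul_weakLE_simple_mul {x y : W} {i : B} (hx : ¬cs.IsLeftDescent x i)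
    (h : cs.WeakLE (cs.simple i * x) (cs.simple i * y)) : cs.WeakLE x y := by
  have h1 := cs.length_mul_le x (x⁻¹ * y)
  rw [not_isLeftDescent_iff] at hx
  rw [WeakLE] at h ⊢
  rw [hx, mul_inv_rev, inv_simple, mul_assoc, simple_mul_simple_cancel_left] at h
  rw [mul_inv_cancel_left] at h1
  have := cs.length_simple_mul y i
  omega

variable {cs}

theorem WeakLE.isLeftDescent {x y : W} (h : cs.WeakLE x y) {i : B} (hx : cs.IsLeftDescent x i) :
    cs.IsLeftDescent y i :=
  cs.simple_weakLE_iff.1 ((cs.simple_weakLE_iff.2 hx).trans h)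

variable (cs)

/-- A chain from `x` up to `y` crosses a left descent `i` of `y` at some step. -/
theorem exists_crossing {x y : W} {i : B} (h : cs.WeakLE x y) (hx : ¬cs.IsLeftDescent x i)
    (hy : cs.IsLeftDescent y i) :
    ∃ z, cs.WeakLE x z ∧ ¬cs.IsLeftDescent z i ∧ cs.WeakLE z (cs.simple i * z) ∧
      cs.WeakLE (cs.simple i * z) y := by
  induction hn : cs.length (x⁻¹ * y) generalizing x with
  | zero =>
    rw [length_eq_zero_iff, inv_mul_eq_one] at hn
    exact absurd (hn ▸ hy) hx
  | succ n ih =>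
    obtain ⟨j, hj⟩ := cs.exists_leftDescent_of_ne_one (w := x⁻¹ * y) (by
      intro h1; simp [h1] at hn)
    rw [isLeftDescent_iff] at hj
    have e : cs.simple j * (x⁻¹ * y) = (x * cs.simple j)⁻¹ * y := by simp [mul_assoc]
    have h1 := cs.length_mul_le (x * cs.simple j) ((x * cs.simple j)⁻¹ * y)
    have h2 := cs.length_mul_simple x j
    rw [mul_inv_cancel_left] at h1
    rw [e] at hj
    rw [WeakLE] at h
    have h3 : cs.WeakLE x (x * cs.simple j) := by
      rw [weakLE_mul_iff, length_simple]; omega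
    have h4 : cs.WeakLE (x * cs.simple j) y := by rw [WeakLE]; omega
    by_cases hd : cs.IsLeftDescent (x * cs.simple j) i
    · have := cs.simple_mul_eq_mul_simple hx hd
      rw [← this] at h3 h4
      exact ⟨x, .refl x, hx, h3, h4⟩
    · obtain ⟨z, hz⟩ := ih h4 hd (by omega)
      exact ⟨z, h3.trans hz.1, hz.2⟩

/-- The lifting property of the right weak order. -/
theorem weakLE_simple_mul {x y : W} {i : B} (h : cs.WeakLE x y) (hx : ¬cs.IsLeftDescent x i)
    (hy : cs.IsLeftDescent y i) : cs.WeakLE x (cs.simple i * y) := by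
  obtain ⟨z, hxz, hz, -, hzy⟩ := cs.exists_crossing h hx hy
  refine hxz.trans (cs.weakLE_of_simple_mul_weakLE_simple_mul hz ?_)
  rwa [simple_mul_simple_cancel_left]

theorem simple_mul_weakLE_of_isLeftDescent {x y : W} {i : B} (hx : ¬cs.IsLeftDescent x i)
    (h : cs.WeakLE x y) (hy : cs.IsLeftDescent y i) : cs.WeakLE (cs.simple i * x) y := by
  have h1 := cs.weakLE_simple_mul h hx hy
  have := cs.simple_mul_weakLE_simple_mul hx h1 (cs.isLeftDescent_iff_not_isLeftDescent_mul.1 hy)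
  rwa [simple_mul_simple_cancel_left] at this

/-! ### Standard parabolic subgroups -/

/-- The standard parabolic subgroup generated by the simple reflections in `J`. -/
def parabolic (J : Set B) : Subgroup W := Subgroup.closure (cs.simple '' J)

theorem simple_mem_parabolic {J : Set B} {i : B} (hi : i ∈ J) : cs.simple i ∈ cs.parabolic J :=
  Subgroup.subset_closure ⟨i, hi, rfl⟩

theorem wordProd_mem_parabolic {J : Set B} {ω : List B} (h : ∀ i ∈ ω, i ∈ J) :
    cs.wordProd ω ∈ cs.parabolic J := by
  induction ω with
  | nil => simp
  | cons i ω ih =>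
    rw [wordProd_cons]
    exact mul_mem (cs.simple_mem_parabolic (h i (by simp))) (ih fun j hj => h j (by simp [hj]))

theorem exists_isReduced_simple_mul {J : Set B} {i : B} (hi : i ∈ J) {ω : List B}
    (hω : ∀ j ∈ ω, j ∈ J) (hr : cs.IsReduced ω) :
    ∃ ω' : List B, (∀ j ∈ ω', j ∈ J) ∧ cs.IsReduced ω' ∧
      cs.simple i * cs.wordProd ω = cs.wordProd ω' := by
  rcases cs.length_simple_mul (cs.wordProd ω) i with h | h
  · refine ⟨i :: ω, ?_, ?_, (cs.wordProd_cons i ω).symm⟩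
    · simpa [hi] using hω
    · rw [IsReduced, wordProd_cons, h, hr.eq, List.length_cons]
  · obtain ⟨j, hj, e⟩ := cs.exists_eraseIdx_of_isLeftDescent (cs.isLeftDescent_iff.2 h)
    refine ⟨ω.eraseIdx j, fun l hl => hω l (List.mem_of_mem_eraseIdx hl), ?_, e⟩
    rw [IsReduced, ← e, List.length_eraseIdx_of_lt hj]
    have := hr.eq
    omega

theorem exists_isReduced_of_mem_parabolic {J : Set B} {d : W} (hd : d ∈ cs.parabolic J) :
    ∃ ω : List B, (∀ i ∈ ω, i ∈ J) ∧ cs.IsReduced ω ∧ d = cs.wordProd ω := by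
  induction hd using Subgroup.closure_induction_left with
  | one => exact ⟨[], by simp, by simp [IsReduced], by simp⟩
  | mul_left x hx y _ ih =>
    obtain ⟨i, hi, rfl⟩ := hx
    obtain ⟨ω, hω, hr, rfl⟩ := ih
    exact cs.exists_isReduced_simple_mul hi hω hr
  | inv_mul_cancel x hx y _ ih =>
    obtain ⟨i, hi, rfl⟩ := hx
    obtain ⟨ω, hω, hr, rfl⟩ := ih
    rw [inv_simple]
    exact cs.exists_isReduced_simple_mul hi hω hr

theorem exists_isLeftDescent_of_mem_parabolic {J : Set B} {d : W} (hd : d ∈ cs.parabolic J)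
    (h1 : d ≠ 1) : ∃ i ∈ J, cs.IsLeftDescent d i := by
  obtain ⟨ω, hω, hr, rfl⟩ := cs.exists_isReduced_of_mem_parabolic hd
  cases ω with
  | nil => simp at h1
  | cons i ω =>
    refine ⟨i, hω i (by simp), ?_⟩
    rw [IsLeftDescent, hr.eq, wordProd_cons, simple_mul_simple_cancel_left]
    exact Nat.lt_succ_of_le (cs.length_wordProd_le ω)

theorem eq_simple_of_mem_parabolic {J : Set B} {d : W} (hd : d ∈ cs.parabolic J)
    (h1 : cs.length d = 1) : ∃ i ∈ J, d = cs.simple i := by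
  obtain ⟨i, hi, h⟩ := cs.exists_isLeftDescent_of_mem_parabolic hd (by rintro rfl; simp at h1)
  refine ⟨i, hi, ?_⟩
  rw [isLeftDescent_iff, h1, Nat.add_eq_right, length_eq_zero_iff, mul_eq_one_iff_inv_eq,
    inv_simple] at h
  exact h.symm

/-- Take `y` of minimal length in its coset. Were a length to drop, exchange would delete a letter
either from the reduced word in `J`, or from `y`, giving a shorter coset element. -/
theorem exists_eq_mul_length_add (J : Set B) (u : W) :
    ∃ d ∈ cs.parabolic J, ∃ y, u = d * y ∧
      ∀ d' ∈ cs.parabolic J, cs.length (d' * y) = cs.length d' + cs.length y := by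
  obtain ⟨y, ⟨d, hd, hu⟩, hmin⟩ := WellFounded.has_min (measure cs.length).wf
    {y | ∃ d ∈ cs.parabolic J, u = d * y} ⟨u, 1, one_mem _, by simp⟩
  refine ⟨d, hd, y, hu, fun d' hd' => ?_⟩
  obtain ⟨ω, hω, hr, rfl⟩ := cs.exists_isReduced_of_mem_parabolic hd'
  clear hd'
  rw [hr.eq]
  induction ω with
  | nil => simp
  | cons i ω ih =>
    have hω' : ∀ j ∈ ω, j ∈ J := fun j hj => hω j (by simp [hj])
    have hr' : cs.IsReduced ω := by simpa using hr.drop 1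
    have ih := ih hω' hr'
    rw [wordProd_cons, mul_assoc, List.length_cons]
    rcases cs.length_simple_mul (cs.wordProd ω * y) i with h | h
    · omega
    exfalso
    obtain ⟨υ, hυ, hy⟩ := cs.exists_isReduced y
    have hdesc : cs.IsLeftDescent (cs.wordProd (ω ++ υ)) i := by
      rw [wordProd_append, ← hy, isLeftDescent_iff]
      exact h
    obtain ⟨j, hj, e⟩ := cs.exists_eraseIdx_of_isLeftDescent hdesc
    rw [wordProd_append, ← mul_assoc] at e
    rcases lt_or_ge j ω.length with hjω | hjω
    · rw [List.eraseIdx_append_of_lt_length hjω, wordProd_append, mul_left_inj] at e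
      have h1 := hr.eq
      have h2 := cs.length_wordProd_le (ω.eraseIdx j)
      rw [wordProd_cons, e, List.length_cons] at h1
      rw [List.length_eraseIdx_of_lt hjω] at h2
      omega
    · rw [List.eraseIdx_append_of_length_le hjω, wordProd_append, ← hy] at e
      set k := j - ω.length
      have hk : k < υ.length := by
        rw [List.length_append] at hj
        omega
      refine hmin (cs.wordProd (υ.eraseIdx k))
        ⟨d * (cs.wordProd ω)⁻¹ * cs.simple i * cs.wordProd ω, ?_, ?_⟩ ?_
      · exact mul_mem (mul_mem (mul_mem hd (inv_mem (cs.wordProd_mem_parabolic hω')))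
          (cs.simple_mem_parabolic (hω i (by simp)))) (cs.wordProd_mem_parabolic hω')
      · rw [mul_assoc _ (cs.wordProd ω), ← e, hu]
        simp [mul_assoc]
      · change cs.length _ < cs.length y
        have h2 := cs.length_wordProd_le (υ.eraseIdx k)
        rw [List.length_eraseIdx_of_lt hk] at h2
        rw [hy, hυ.eq]
        omega

theorem length_mul_of_mem_parabolic {J : Set B} {y : W} (hy : ∀ i ∈ J, ¬cs.IsLeftDescent y i)
    {d : W} (hd : d ∈ cs.parabolic J) : cs.length (d * y) = cs.length d + cs.length y := by
  obtain ⟨c, hc, z, rfl, hz⟩ := cs.exists_eq_mul_length_add J y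
  by_cases h1 : c = 1
  · simpa [h1] using hz d hd
  obtain ⟨i, hi, h⟩ := cs.exists_isLeftDescent_of_mem_parabolic hc h1
  refine absurd ?_ (hy i hi)
  rw [IsLeftDescent, ← mul_assoc, hz _ hc, hz _ (mul_mem (cs.simple_mem_parabolic hi) hc)]
  exact Nat.add_lt_add_right h _

theorem exists_parabolic_decomposition (J : Set B) (u : W) :
    ∃ d ∈ cs.parabolic J, ∃ y, u = d * y ∧ ∀ i ∈ J, ¬cs.IsLeftDescent y i := by
  obtain ⟨d, hd, y, hu, hy⟩ := cs.exists_eq_mul_length_add J u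
  refine ⟨d, hd, y, hu, fun i hi => ?_⟩
  rw [not_isLeftDescent_iff, hy _ (cs.simple_mem_parabolic hi), length_simple, add_comm]

theorem isLeftDescent_mul_iff_of_mem_parabolic {J : Set B} {y : W}
    (hy : ∀ i ∈ J, ¬cs.IsLeftDescent y i) {d : W} (hd : d ∈ cs.parabolic J) {i : B} (hi : i ∈ J) :
    cs.IsLeftDescent (d * y) i ↔ cs.IsLeftDescent d i := by
  rw [IsLeftDescent, IsLeftDescent, ← mul_assoc, cs.length_mul_of_mem_parabolic hy hd,
    cs.length_mul_of_mem_parabolic hy (mul_mem (cs.simple_mem_parabolic hi) hd)]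
  omega

/-- An element that has all of `J` as left descents is above the whole parabolic subgroup. -/
theorem weakLE_of_mem_parabolic {J : Set B} {w : W} (hw : ∀ i ∈ J, cs.IsLeftDescent w i) {d : W}
    (hd : d ∈ cs.parabolic J) : cs.WeakLE d w := by
  obtain ⟨ω, hω, hr, rfl⟩ := cs.exists_isReduced_of_mem_parabolic hd
  clear hd
  induction ω with
  | nil => simpa using cs.one_weakLE w
  | cons i ω ih =>
    have hr' : cs.IsReduced ω := by simpa using hr.drop 1
    rw [wordProd_cons]
    refine cs.simple_mul_weakLE_of_isLeftDescent ?_ (ih (fun j hj => hω j (by simp [hj])) hr')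
      (hw i (hω i (by simp)))
    rw [not_isLeftDescent_iff, ← wordProd_cons, hr.eq, hr'.eq, List.length_cons]

/-! ### Joins and meets in the right weak order -/

/-- `j` is the least upper bound of `a` and `b` in the right weak order. -/
structure IsWeakJoin (a b j : W) : Prop where
  left : cs.WeakLE a j
  right : cs.WeakLE b j
  le : ∀ u, cs.WeakLE a u → cs.WeakLE b u → cs.WeakLE j u

/-- `z` is the greatest lower bound of `a` and `b` in the right weak order. -/
structure IsWeakMeet (a b z : W) : Prop where
  left : cs.WeakLE z a
  right : cs.WeakLE z b
  le : ∀ u, cs.WeakLE u a → cs.WeakLE u b → cs.WeakLE u z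

/-- Left multiplication by `s_i` is an order isomorphism from the elements without left descent `i`
to those with it. -/
theorem weakLE_simple_mul_iff {x y : W} {i : B} (hx : cs.IsLeftDescent x i) :
    cs.WeakLE (cs.simple i * x) y ∧ ¬cs.IsLeftDescent y i ↔ cs.WeakLE x (cs.simple i * y) := by
  have hx' := cs.isLeftDescent_iff_not_isLeftDescent_mul.1 hx
  constructor
  · rintro ⟨h, hy⟩
    simpa using cs.simple_mul_weakLE_simple_mul hx' h hy
  · intro h
    have hy : ¬cs.IsLeftDescent y i := by
      simpa using cs.isLeftDescent_iff_not_isLeftDescent_mul.1 (h.isLeftDescent hx)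
    exact ⟨cs.weakLE_of_simple_mul_weakLE_simple_mul hx' (by simpa using h), hy⟩

theorem IsWeakJoin.simple_mul {a b j : W} {i : B} (h : cs.IsWeakJoin a b j)
    (ha : ¬cs.IsLeftDescent a i) (hb : ¬cs.IsLeftDescent b i) :
    ¬cs.IsLeftDescent j i ∧
      cs.IsWeakJoin (cs.simple i * a) (cs.simple i * b) (cs.simple i * j) := by
  -- Otherwise lifting makes `s_i j` a shorter upper bound.
  have hj : ¬cs.IsLeftDescent j i := fun hj =>
    absurd (h.le _ (cs.weakLE_simple_mul h.left ha hj)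
      (cs.weakLE_simple_mul h.right hb hj)).length_le (not_le.2 hj)
  have key : ∀ x, ¬cs.IsLeftDescent x i → cs.IsLeftDescent (cs.simple i * x) i := fun x hx => by
    rwa [isLeftDescent_iff_not_isLeftDescent_mul, simple_mul_simple_cancel_left]
  refine ⟨hj, cs.simple_mul_weakLE_simple_mul ha h.left hj,
    cs.simple_mul_weakLE_simple_mul hb h.right hj, fun u hau hbu => ?_⟩
  have hu := hau.isLeftDescent (key a ha)
  have hu' := cs.isLeftDescent_iff_not_isLeftDescent_mul.1 hu
  have key2 : ∀ x, ¬cs.IsLeftDescent x i → cs.WeakLE (cs.simple i * x) u →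
      cs.WeakLE x (cs.simple i * u) := fun x hx hxu =>
    cs.weakLE_of_simple_mul_weakLE_simple_mul hx (by simpa using hxu)
  have := cs.simple_mul_weakLE_simple_mul hj (h.le _ (key2 a ha hau) (key2 b hb hbu)) hu'
  simpa using this

/-- Two elements with an upper bound have a least upper bound. -/
theorem exists_isWeakJoin {a b x : W} (ha : cs.WeakLE a x) (hb : cs.WeakLE b x) :
    ∃ j, cs.IsWeakJoin a b j := by
  induction hn : cs.length x using Nat.strong_induction_on generalizing a b x with
  | _ n ih =>
  -- With a common left descent, cancel it and use induction below the shorter bound `s_i x`.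
  have common : ∀ {a b : W} {i : B}, cs.WeakLE a x → cs.WeakLE b x → cs.IsLeftDescent a i →
      cs.IsLeftDescent b i → ∃ j, cs.IsWeakJoin a b j := by
    intro a b i ha hb hai hbi
    have hxi := ha.isLeftDescent hai
    have ha' := (cs.weakLE_simple_mul_iff (y := cs.simple i * x) hai).2 (by simpa using ha)
    have hb' := (cs.weakLE_simple_mul_iff (y := cs.simple i * x) hbi).2 (by simpa using hb)
    obtain ⟨j, hj⟩ := ih _ (hn ▸ hxi) ha'.1 hb'.1 rfl
    refine ⟨cs.simple i * j, ?_⟩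
    simpa using (hj.simple_mul cs (cs.isLeftDescent_iff_not_isLeftDescent_mul.1 hai)
      (cs.isLeftDescent_iff_not_isLeftDescent_mul.1 hbi)).2
  by_cases ha1 : a = 1
  · exact ⟨b, ha1 ▸ cs.one_weakLE b, .refl b, fun u _ h => h⟩
  by_cases hb1 : b = 1
  · exact ⟨a, .refl a, hb1 ▸ cs.one_weakLE a, fun u h _ => h⟩
  obtain ⟨s, hs⟩ := cs.exists_leftDescent_of_ne_one ha1
  obtain ⟨t, ht⟩ := cs.exists_leftDescent_of_ne_one hb1
  -- The parabolic factor `d` has both descents and lies below every upper bound of `a` and `b`, so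
  -- a ∨ b = (a ∨ d) ∨ (b ∨ d), where each join is of elements with a common left descent.
  obtain ⟨d, hd, y, hxd, hy⟩ := cs.exists_parabolic_decomposition {s, t} x
  have hdx : cs.WeakLE d x := by
    rw [hxd, weakLE_mul_iff, cs.length_mul_of_mem_parabolic hy hd]
  have hds : cs.IsLeftDescent d s := by
    rw [← cs.isLeftDescent_mul_iff_of_mem_parabolic hy hd (by simp), ← hxd]
    exact ha.isLeftDescent hs
  have hdt : cs.IsLeftDescent d t := by
    rw [← cs.isLeftDescent_mul_iff_of_mem_parabolic hy hd (by simp), ← hxd]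
    exact hb.isLeftDescent ht
  obtain ⟨p, hp⟩ := common ha hdx hs hds
  obtain ⟨q, hq⟩ := common hb hdx ht hdt
  obtain ⟨j, hj⟩ := common (hp.le x ha hdx) (hq.le x hb hdx) (hp.left.isLeftDescent hs)
    (hq.right.isLeftDescent hds)
  refine ⟨j, hp.left.trans hj.left, hq.left.trans hj.right, fun u hau hbu => ?_⟩
  have hdu : cs.WeakLE d u := cs.weakLE_of_mem_parabolic (J := {s, t}) (by
    rintro i (rfl | rfl)
    exacts [hau.isLeftDescent hs, hbu.isLeftDescent ht]) hd
  exact hj.le u (hp.le u hau hdu) (hq.le u hbu hdu)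

/-- A common lower bound of maximal length absorbs any other, since their join is again a common
lower bound. -/
theorem exists_isWeakMeet (a b : W) : ∃ z, cs.IsWeakMeet a b z := by
  obtain ⟨z, ⟨hza, hzb⟩, hmin⟩ := WellFounded.has_min
    (measure fun z => cs.length a - cs.length z).wf
    {z | cs.WeakLE z a ∧ cs.WeakLE z b} ⟨1, cs.one_weakLE a, cs.one_weakLE b⟩
  refine ⟨z, hza, hzb, fun u hua hub => ?_⟩
  obtain ⟨j, hj⟩ := cs.exists_isWeakJoin hza hua
  have hja := hj.le a hza hua
  have : ¬cs.length a - cs.length j < cs.length a - cs.length z :=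
    hmin j ⟨hja, hj.le b hzb hub⟩
  rw [hj.left.eq_of_length_le (by have := hja.length_le; omega)]
  exact hj.right

theorem IsWeakMeet.simple_mul {x y z : W} {i : B} (h : cs.IsWeakMeet x y z)
    (hx : ¬cs.IsLeftDescent x i) (hy : ¬cs.IsLeftDescent y i) :
    cs.IsWeakMeet (cs.simple i * x) (cs.simple i * y) (cs.simple i * z) := by
  have hz : ¬cs.IsLeftDescent z i := fun hz => hx (h.left.isLeftDescent hz)
  have key : ∀ x, ¬cs.IsLeftDescent x i → cs.IsLeftDescent (cs.simple i * x) i := fun x hx => by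
    rwa [isLeftDescent_iff_not_isLeftDescent_mul, simple_mul_simple_cancel_left]
  refine ⟨cs.simple_mul_weakLE_simple_mul hz h.left hx,
    cs.simple_mul_weakLE_simple_mul hz h.right hy, fun u hux huy => ?_⟩
  -- `u` need not have left descent `i`; its join with `s_i` does, and is still a common lower
  -- bound, so `s_i` can be stripped.
  obtain ⟨p, hp⟩ := cs.exists_isWeakJoin hux (cs.simple_weakLE_iff.2 (key x hx))
  have hpi := cs.simple_weakLE_iff.1 hp.right
  have h1 := ((cs.weakLE_simple_mul_iff hpi).2
    (hp.le _ hux (cs.simple_weakLE_iff.2 (key x hx)))).1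
  have h2 := ((cs.weakLE_simple_mul_iff hpi).2
    (hp.le _ huy (cs.simple_weakLE_iff.2 (key y hy)))).1
  exact hp.left.trans ((cs.weakLE_simple_mul_iff hpi).1 ⟨h.le _ h1 h2, hz⟩)

/-- The geometric representation separates generators: the i-th coordinate of `s_i α_i` is -1, that
of `s_j α_i` is 1 for j ≠ i. -/
theorem simple_injective : Function.Injective cs.simple := by
  intro i j hij
  by_contra hne
  have h1 : M.simpleReflection i (M.simpleRoot i) = M.simpleReflection j (M.simpleRoot i) := by
    rw [← cs.rootAction_simple, ← cs.rootAction_simple, hij]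
  have h2 := DFunLike.congr_fun h1 i
  simp only [CoxeterMatrix.simpleReflection_apply, M.rootForm_simpleRoot, M.diagonal] at h2
  simp [CoxeterMatrix.simpleRoot, hne] at h2

/-! ### Cone types -/

/-- The lengths of `x⁻¹` and `v` add up in the product `x⁻¹ v`; that is, `v` is in the cone type
of `x⁻¹`. -/
def Perp (x v : W) : Prop := cs.length (x⁻¹ * v) = cs.length x + cs.length v

theorem mem_coneType_inv {x v : W} : v ∈ cs.coneType x⁻¹ ↔ cs.Perp x v := by
  simp [coneType, Perp]

theorem perp_one (x : W) : cs.Perp x 1 := by simp [Perp]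

variable {cs}

theorem Perp.mono_left {a b v : W} (h : cs.Perp b v) (hab : cs.WeakLE a b) : cs.Perp a v := by
  have h1 := cs.length_mul_le (a⁻¹ * b)⁻¹ (a⁻¹ * v)
  have h2 := cs.length_mul_le a⁻¹ v
  rw [length_inv] at h1 h2
  rw [mul_inv_rev, inv_inv, mul_assoc, mul_inv_cancel_left] at h1
  rw [Perp] at h ⊢
  rw [WeakLE] at hab
  omega

theorem Perp.not_isLeftDescent {x v : W} (h : cs.Perp x v) {i : B} (hv : cs.IsLeftDescent v i) :
    ¬cs.IsLeftDescent x i := by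
  intro hx
  rw [isLeftDescent_iff] at hx hv
  have h1 := cs.length_mul_le (cs.simple i * x)⁻¹ (cs.simple i * v)
  rw [length_inv, mul_inv_rev, inv_simple, mul_assoc, simple_mul_simple_cancel_left] at h1
  rw [Perp] at h
  omega

variable (cs)

theorem perp_simple_iff {x : W} {i : B} : cs.Perp x (cs.simple i) ↔ ¬cs.IsLeftDescent x i := by
  rw [Perp, not_isLeftDescent_iff, ← cs.length_inv (x⁻¹ * _)]
  simp

/-- Moving a letter from `v` to `x` keeps both x⁻¹v and the sum of lengths. This is the step of the
inductions on the length of `v`. -/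
theorem perp_simple_mul_iff {x v : W} {i : B} (hx : ¬cs.IsLeftDescent x i)
    (hv : cs.IsLeftDescent v i) : cs.Perp (cs.simple i * x) (cs.simple i * v) ↔ cs.Perp x v := by
  rw [not_isLeftDescent_iff] at hx
  rw [isLeftDescent_iff] at hv
  rw [Perp, Perp, mul_inv_rev, inv_simple, mul_assoc, simple_mul_simple_cancel_left]
  omega

/-- The cone type of the inverse of a join is the intersection of the cone types. -/
theorem IsWeakJoin.perp {a b j v : W} (h : cs.IsWeakJoin a b j) (ha : cs.Perp a v)
    (hb : cs.Perp b v) : cs.Perp j v := by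
  induction hn : cs.length v using Nat.strong_induction_on generalizing a b j v with
  | _ n ih =>
  by_cases hv : v = 1
  · exact hv ▸ cs.perp_one j
  obtain ⟨i, hi⟩ := cs.exists_leftDescent_of_ne_one hv
  have hai := ha.not_isLeftDescent hi
  have hbi := hb.not_isLeftDescent hi
  obtain ⟨hji, hj⟩ := h.simple_mul cs hai hbi
  rw [← cs.perp_simple_mul_iff hji hi]
  exact ih _ (hn ▸ hi) hj ((cs.perp_simple_mul_iff hai hi).2 ha)
    ((cs.perp_simple_mul_iff hbi hi).2 hb) rfl

theorem coneType_inv_eq_iff {x y : W} :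
    cs.coneType x⁻¹ = cs.coneType y⁻¹ ↔ ∀ v, cs.Perp x v ↔ cs.Perp y v := by
  simp only [Set.ext_iff, mem_coneType_inv]

theorem perp_simple_mul_congr {x y : W} {i : B} (hx : ¬cs.IsLeftDescent x i)
    (hy : ¬cs.IsLeftDescent y i) (h : ∀ v, cs.Perp x v ↔ cs.Perp y v) (v : W) :
    cs.Perp (cs.simple i * x) v ↔ cs.Perp (cs.simple i * y) v := by
  by_cases hv : cs.IsLeftDescent v i
  · have key : ∀ x, ¬cs.IsLeftDescent x i → ¬cs.Perp (cs.simple i * x) v := fun x hx hp =>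
      hp.not_isLeftDescent hv (by
        rwa [isLeftDescent_iff_not_isLeftDescent_mul, simple_mul_simple_cancel_left])
    exact iff_of_false (key x hx) (key y hy)
  · have hv' : cs.IsLeftDescent (cs.simple i * v) i := by
      rwa [isLeftDescent_iff_not_isLeftDescent_mul, simple_mul_simple_cancel_left]
    have := h (cs.simple i * v)
    rwa [← cs.perp_simple_mul_iff hx hv', ← cs.perp_simple_mul_iff hy hv',
      simple_mul_simple_cancel_left] at this

/-- The parts of the cone type partition are closed under meets. -/
theorem IsWeakMeet.perp {x y z v : W} (h : cs.IsWeakMeet x y z)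
    (hxy : ∀ v, cs.Perp x v ↔ cs.Perp y v) (hz : cs.Perp z v) : cs.Perp x v := by
  induction hn : cs.length v using Nat.strong_induction_on generalizing x y z v with
  | _ n ih =>
  by_cases hv : v = 1
  · exact hv ▸ cs.perp_one x
  obtain ⟨i, hi⟩ := cs.exists_leftDescent_of_ne_one hv
  have hzi := hz.not_isLeftDescent hi
  have hiff : cs.IsLeftDescent x i ↔ cs.IsLeftDescent y i := by
    rw [← not_iff_not, ← perp_simple_iff, ← perp_simple_iff, hxy]
  have hxi : ¬cs.IsLeftDescent x i := fun hx => hzi (cs.simple_weakLE_iff.1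
    (h.le _ (cs.simple_weakLE_iff.2 hx) (cs.simple_weakLE_iff.2 (hiff.1 hx))))
  have hyi := hiff.not.1 hxi
  rw [← cs.perp_simple_mul_iff hxi hi]
  exact ih _ (hn ▸ hi) (h.simple_mul cs hxi hyi) (cs.perp_simple_mul_congr hxi hyi hxy)
    ((cs.perp_simple_mul_iff hzi hi).2 hz) rfl

/-! ### Gates -/

theorem mem_gates_iff {g : W} : g ∈ cs.gates ↔
    ∀ x, (∀ v, cs.Perp x v ↔ cs.Perp g v) → cs.length g ≤ cs.length x := by
  constructor
  · rintro ⟨T, -, hg, hmin⟩ x hx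
    exact hmin x (((cs.coneType_inv_eq_iff).2 hx).trans hg)
  · intro h
    exact ⟨cs.coneType g⁻¹, ⟨_, rfl⟩, rfl, fun x hx => h x (cs.coneType_inv_eq_iff.1 hx)⟩

/-- A gate is the smallest element of its part. -/
theorem weakLE_of_mem_gates {g x : W} (hg : g ∈ cs.gates)
    (h : ∀ v, cs.Perp x v ↔ cs.Perp g v) : cs.WeakLE g x := by
  obtain ⟨z, hz⟩ := cs.exists_isWeakMeet g x
  have hle := cs.mem_gates_iff.1 hg z fun v =>
    ⟨hz.perp cs fun v => (h v).symm, fun hv => hv.mono_left hz.left⟩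
  rw [← hz.left.eq_of_length_le hle]
  exact hz.right

theorem exists_gate (x : W) :
    ∃ g ∈ cs.gates, cs.WeakLE g x ∧ ∀ v, cs.Perp g v ↔ cs.Perp x v := by
  obtain ⟨g, hg, hmin⟩ := WellFounded.has_min (measure cs.length).wf
    {y | ∀ v, cs.Perp y v ↔ cs.Perp x v} ⟨x, fun _ => Iff.rfl⟩
  have hgate : g ∈ cs.gates := cs.mem_gates_iff.2 fun y hy =>
    not_lt.1 (hmin y fun v => (hy v).trans (hg v))
  exact ⟨g, hgate, cs.weakLE_of_mem_gates hgate fun v => (hg v).symm, hg⟩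

theorem one_mem_gates : (1 : W) ∈ cs.gates := cs.mem_gates_iff.2 fun x _ => by simp

theorem exists_isRightDescent_weakLE {x y : W} (h : cs.WeakLE x y) (hne : x ≠ y) :
    ∃ i, cs.IsRightDescent y i ∧ cs.WeakLE x (y * cs.simple i) := by
  obtain ⟨i, hi⟩ := cs.exists_rightDescent_of_ne_one (w := x⁻¹ * y) (by rwa [ne_eq, inv_mul_eq_one])
  rw [isRightDescent_iff] at hi
  have h1 := cs.length_mul_le x (x⁻¹ * (y * cs.simple i))
  have h2 := cs.length_mul_simple y i
  rw [mul_inv_cancel_left] at h1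
  rw [mul_assoc] at hi
  rw [WeakLE] at h
  refine ⟨i, ?_, ?_⟩
  · rw [isRightDescent_iff]
    omega
  · rw [WeakLE]
    omega

/-- If removing the right descent `r` of `x` does not change the cone type, then removing the
other generator of a rank two residue below `x` is also invisible from its bottom element. -/
theorem exists_weakLE_perp_of_isRightDescent {x : W} {r q : B} (hr : cs.IsRightDescent x r)
    (hq : cs.IsRightDescent x q) (hrq : r ≠ q)
    (hx : ∀ v, cs.Perp (x * cs.simple r) v → cs.Perp x v) :
    ∃ h, cs.WeakLE h (x * cs.simple r) ∧ cs.WeakLE h (x * cs.simple q) ∧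
      ∀ v, cs.Perp h v → cs.Perp (x * cs.simple q) v := by
  obtain ⟨d, hd, k, hxd, hk⟩ := cs.exists_parabolic_decomposition {r, q} x⁻¹
  set P := cs.parabolic {r, q} with hP
  have hrP : cs.simple r ∈ P := cs.simple_mem_parabolic (by simp)
  have hqP : cs.simple q ∈ P := cs.simple_mem_parabolic (by simp)
  have hdr : cs.IsLeftDescent d r := by
    rwa [← cs.isLeftDescent_mul_iff_of_mem_parabolic hk hd (by simp), ← hxd,
      isLeftDescent_inv_iff]
  have hdq : cs.IsLeftDescent d q := by
    rwa [← cs.isLeftDescent_mul_iff_of_mem_parabolic hk hd (by simp), ← hxd,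
      isLeftDescent_inv_iff]
  have htop : ∀ {f : W}, f ∈ P → cs.WeakLE f d := fun hf =>
    cs.weakLE_of_mem_parabolic (J := {r, q}) (by rintro i (rfl | rfl) <;> assumption) hf
  -- `d` is the longest element of the dihedral group `P`, hence an involution; conjugation by it
  -- permutes the two generators, sending `r` to `e` and `q` to `e'`.
  have hdinv : d⁻¹ = d := (htop (inv_mem hd)).eq_of_length_le (by simp)
  have hdd : d * d = 1 := by rw [← inv_eq_iff_mul_eq_one, hdinv]
  have hxk : x = k⁻¹ * d := by rw [← hdinv, ← mul_inv_rev, ← hxd, inv_inv]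
  have hkP : ∀ {f : W}, f ∈ P → cs.length (k⁻¹ * f) = cs.length k + cs.length f := by
    intro f hf
    have := cs.length_mul_of_mem_parabolic hk (inv_mem hf)
    rwa [← length_inv, mul_inv_rev, inv_inv, cs.length_inv, add_comm] at this
  have hdP : ∀ {f : W}, f ∈ P → cs.length (d * f) + cs.length f = cs.length d := by
    intro f hf
    have := htop hf
    rw [WeakLE, ← cs.length_inv (f⁻¹ * d), mul_inv_rev, inv_inv, hdinv] at this
    omega
  have hconj : ∀ {s : W}, s ∈ P → cs.length s = 1 → cs.length (d * s * d) = 1 := by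
    intro s hs h1
    have h2 := hdP (inv_mem hs)
    have h3 := hdP (mul_mem hs hd)
    rw [← cs.length_inv (s * d), mul_inv_rev, hdinv, ← mul_assoc] at h3
    rw [cs.length_inv] at h2
    omega
  obtain ⟨e, he, hde⟩ := cs.eq_simple_of_mem_parabolic (mul_mem (mul_mem hd hrP) hd)
    (hconj hrP (cs.length_simple r))
  obtain ⟨e', he', hde'⟩ := cs.eq_simple_of_mem_parabolic (mul_mem (mul_mem hd hqP) hd)
    (hconj hqP (cs.length_simple q))
  have hee : e ≠ e' := by
    rintro rfl
    exact hrq (cs.simple_injective (by simpa using hde.trans hde'.symm))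
  have hJ : ∀ i ∈ ({r, q} : Set B), i = e ∨ i = e' := by
    simp only [Set.mem_insert_iff, Set.mem_singleton_iff] at he he' ⊢
    grind
  have hre : cs.simple r * d = d * cs.simple e := by
    rw [← hde, ← mul_assoc, ← mul_assoc, hdd, one_mul]
  have hqe : cs.simple q * d = d * cs.simple e' := by
    rw [← hde', ← mul_assoc, ← mul_assoc, hdd, one_mul]
  have hlen : ∀ {s : W}, s ∈ P → cs.length (x * s) = cs.length k + cs.length (d * s) := by
    intro s hs
    rw [hxk, mul_assoc, hkP (mul_mem hd hs)]
  have hlow : ∀ {s : W}, s ∈ P → cs.WeakLE k⁻¹ (x * s) := by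
    intro s hs
    rw [hxk, mul_assoc, weakLE_mul_iff, hkP (mul_mem hd hs), length_inv]
  refine ⟨k⁻¹, hlow hrP, hlow hqP, fun v hv => ?_⟩
  -- Otherwise a chain from `k` to `u` crosses `e` at some `y` minimal in its coset P y, and k⁻¹ e y
  -- would be in the cone type of (xr)⁻¹ but not in that of x⁻¹.
  have no_crossing : ∀ u, cs.WeakLE k u → cs.IsLeftDescent u e → cs.IsLeftDescent u e' := by
    intro u hku hue
    by_contra hue'
    obtain ⟨y, hky, hye, hyey, hyu⟩ := cs.exists_crossing hku (hk e he) hue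
    have hy : ∀ i ∈ ({r, q} : Set B), ¬cs.IsLeftDescent y i := by
      intro i hi
      rcases hJ i hi with rfl | rfl
      · exact hye
      · exact fun h => hue' ((hyey.trans hyu).isLeftDescent h)
    have h1 := hky.trans hyey
    have h2 := cs.not_isLeftDescent_iff.1 hye
    have h3 := hdP (cs.simple_mem_parabolic he)
    have h4 := hdP hrP
    have h5 := hx (k⁻¹ * (cs.simple e * y)) (by
      have h6 : (x * cs.simple r)⁻¹ * (k⁻¹ * (cs.simple e * y)) = d * y := by
        rw [mul_inv_rev, inv_simple, hxd]
        simp only [mul_assoc, mul_inv_cancel_left]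
        rw [← mul_assoc, hre]
        simp [mul_assoc]
      rw [Perp, h6, cs.length_mul_of_mem_parabolic hy hd, hlen hrP]
      rw [WeakLE] at h1
      rw [length_simple] at h4
      omega)
    rw [Perp, hxd, mul_assoc, mul_inv_cancel_left, ← mul_assoc,
      cs.length_mul_of_mem_parabolic hy (mul_mem hd (cs.simple_mem_parabolic he))] at h5
    have h7 := hlen (one_mem P)
    rw [mul_one, mul_one] at h7
    rw [WeakLE] at h1
    rw [length_simple] at h3
    omega
  obtain ⟨c, hc, y, hu, hy⟩ := cs.exists_parabolic_decomposition {r, q} (k * v)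
  have hku : cs.WeakLE k (k * v) := by
    rw [weakLE_mul_iff]
    simpa [Perp] using hv
  -- Any other `c`, after removing a left descent `e'` if there is one, yields an element above `k`
  -- with left descent `e` but not `e'`.
  have hc' : c = 1 ∨ c = cs.simple e' := by
    by_contra! hne
    have main : ∀ f ∈ P, f ≠ 1 → ¬cs.IsLeftDescent f e' → ¬cs.WeakLE k (f * y) := by
      intro f hf hf1 hfe' hkf
      obtain ⟨i, hi, hfi⟩ := cs.exists_isLeftDescent_of_mem_parabolic hf hf1
      rcases hJ i hi with rfl | rfl
      · exact hfe' ((cs.isLeftDescent_mul_iff_of_mem_parabolic hy hf he').1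
          (no_crossing _ hkf ((cs.isLeftDescent_mul_iff_of_mem_parabolic hy hf he).2 hfi)))
      · exact hfe' hfi
    rw [hu] at hku
    by_cases hce' : cs.IsLeftDescent c e'
    · refine main (cs.simple e' * c) (mul_mem (cs.simple_mem_parabolic he') hc) ?_
        (cs.isLeftDescent_iff_not_isLeftDescent_mul.1 hce') ?_
      · rw [ne_eq, mul_eq_one_iff_inv_eq, inv_simple]
        exact hne.2.symm
      · rw [mul_assoc]
        exact cs.weakLE_simple_mul hku (hk e' he')
          ((cs.isLeftDescent_mul_iff_of_mem_parabolic hy hc he').2 hce')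
    · exact main c hc hne.1 hce' hku
  have h1 : (x * cs.simple q)⁻¹ * v = d * cs.simple e' * c * y := by
    rw [mul_inv_rev, inv_simple, hxd, ← hqe]
    simp only [mul_assoc, ← hu]
  -- For these two values of `c`, the product of d e' with `c` is length-additive.
  have h2 : cs.length (d * cs.simple e' * c) + 1 = cs.length d + cs.length c := by
    rcases hc' with rfl | rfl
    · simpa using hdP (cs.simple_mem_parabolic he')
    · simp
  have h3 := hdP hqP
  rw [weakLE_mul_iff] at hku
  rw [hu, cs.length_mul_of_mem_parabolic hy hc] at hku
  rw [Perp, h1, cs.length_mul_of_mem_parabolic hy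
    (mul_mem (mul_mem hd (cs.simple_mem_parabolic he')) hc), hlen hqP]
  rw [length_simple] at h3
  omega

/-- A gate below `x` is below every `y` that is below `x` and lies in the same part. -/
theorem gate_weakLE {x y a : W} (ha : a ∈ cs.gates) (hax : cs.WeakLE a x) (hyx : cs.WeakLE y x)
    (h : ∀ v, cs.Perp y v → cs.Perp x v) : cs.WeakLE a y := by
  induction hn : cs.length x using Nat.strong_induction_on generalizing x y with
  | _ n ih =>
  by_cases hne : y = x
  · rwa [hne]
  obtain ⟨r, hr, hyr⟩ := cs.exists_isRightDescent_weakLE hyx hne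
  have hrx : ∀ v, cs.Perp (x * cs.simple r) v → cs.Perp x v := fun v hv => h v (hv.mono_left hyr)
  have har : cs.WeakLE a (x * cs.simple r) := by
    -- `x` is no gate, as the shorter x r lies in its part.
    have hax' : a ≠ x := by
      rintro rfl
      exact absurd (cs.mem_gates_iff.1 ha (a * cs.simple r) fun v =>
        ⟨hrx v, fun hv => hv.mono_left (cs.mul_simple_weakLE_iff.2 hr)⟩) (not_le.2 hr)
    obtain ⟨q, hq, haq⟩ := cs.exists_isRightDescent_weakLE hax hax'
    by_cases hrq : r = q
    · rwa [hrq]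
    obtain ⟨b, hbr, hbq, hb⟩ := cs.exists_weakLE_perp_of_isRightDescent hr hq hrq hrx
    exact (ih _ (hn ▸ hq) haq hbq hb rfl).trans hbr
  exact ih _ (hn ▸ hr) har hyr
    (fun v hv => (h v hv).mono_left (cs.mul_simple_weakLE_iff.2 hr)) rfl

theorem gates_le_iff {a b : cs.gates} : a ≤ b ↔ cs.WeakLE a.1 b.1 := Iff.rfl

theorem ncard_rightDescentRoots_eq_one_iff {w : W} :
    (cs.rightDescentRoots w).ncard = 1 ↔ ∃! i, cs.IsRightDescent w i := by
  have hinj : Function.Injective fun i => -cs.rootAction w (M.simpleRoot i) := by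
    intro i j hij
    exact Finsupp.single_left_injective one_ne_zero ((cs.rootAction w).injective (neg_injective hij))
  have himg : cs.rightDescentRoots w =
      (fun i => -cs.rootAction w (M.simpleRoot i)) '' {i | cs.IsRightDescent w i} := by
    ext β
    simp only [rightDescentRoots, Set.mem_ofPred_eq, Set.mem_image]
    exact exists_congr fun i => and_congr_right fun _ => eq_comm
  rw [himg, Set.ncard_image_of_injective _ hinj, Set.ncard_eq_one]
  simp only [Set.eq_singleton_iff_unique_mem, Set.mem_ofPred_eq]
  rfl

end CoxeterSystem

theorem theorem1p8 {B W : Type*} [Finite B] [Group W] {M : CoxeterMatrix B}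
    (cs : CoxeterSystem M W) :
    cs.tightGates = {g : W | ∃ h : g ∈ cs.gates, IsJoinIrreducible (⟨g, h⟩ : cs.gates)} := by
  ext g
  simp only [CoxeterSystem.tightGates, Set.mem_ofPred_eq,
    cs.ncard_rightDescentRoots_eq_one_iff]
  constructor
  · rintro ⟨hg, s, hs, huniq⟩
    refine ⟨hg, fun hmin => ?_, fun a b hab => ?_⟩
    · have h1 : cs.WeakLE g 1 :=
        hmin (b := ⟨1, cs.one_mem_gates⟩) (cs.gates_le_iff.2 (cs.one_weakLE g))
      rw [h1.antisymm (cs.one_weakLE g)] at hs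
      exact cs.not_isRightDescent_one s hs
    · by_contra! hne
      obtain ⟨c, hc, hcs, hcv⟩ := cs.exists_gate (g * cs.simple s)
      have key : ∀ a : cs.gates, a ≤ ⟨g, hg⟩ → ⟨g, hg⟩ ≠ a → a ≤ ⟨c, hc⟩ := by
        intro a hag hga
        obtain ⟨i, hi, hai⟩ := cs.exists_isRightDescent_weakLE (cs.gates_le_iff.1 hag)
          (fun h => hga (Subtype.ext h.symm))
        rw [huniq i hi] at hai
        exact cs.gate_weakLE a.2 hai hcs fun v => (hcv v).1
      have hgc : cs.WeakLE g c := hab.2 (show (⟨c, hc⟩ : cs.gates) ∈ upperBounds {a, b} by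
        rintro _ (rfl | rfl)
        · exact key _ (hab.1 (by simp)) hne.1
        · exact key _ (hab.1 (by simp)) hne.2)
      exact absurd (hgc.trans hcs).length_le (not_le.2 hs)
  · rintro ⟨hg, hmin, hirr⟩
    refine ⟨hg, ?_⟩
    have hg1 : g ≠ 1 := by
      rintro rfl
      exact hmin fun b _ => cs.gates_le_iff.2 (cs.one_weakLE b.1)
    obtain ⟨s, hs⟩ := cs.exists_rightDescent_of_ne_one hg1
    refine ⟨s, hs, fun t ht => ?_⟩
    by_contra hts
    have hsg := cs.mul_simple_weakLE_iff.2 hs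
    have htg := cs.mul_simple_weakLE_iff.2 ht
    obtain ⟨a, ha, has, hav⟩ := cs.exists_gate (g * cs.simple s)
    obtain ⟨b, hb, hbt, hbv⟩ := cs.exists_gate (g * cs.simple t)
    obtain ⟨j, hj⟩ := cs.exists_isWeakJoin (has.trans hsg) (hbt.trans htg)
    -- A join shorter than `g` would equal both elements, forcing s = t.
    have hgj : cs.IsWeakJoin (g * cs.simple s) (g * cs.simple t) g := by
      obtain ⟨p, hp⟩ := cs.exists_isWeakJoin hsg htg
      have hpg := hp.le g hsg htg
      suffices p = g from this ▸ hp
      refine hpg.eq_of_length_le ?_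
      by_contra! hlt
      rw [CoxeterSystem.isRightDescent_iff] at hs ht
      have e1 := hp.left.eq_of_length_le (by omega)
      have e2 := hp.right.eq_of_length_le (by omega)
      exact hts (cs.simple_injective (mul_left_cancel (e2.trans e1.symm)))
    have hjg := hj.le g (has.trans hsg) (hbt.trans htg)
    have hj_eq : g = j := by
      refine (cs.weakLE_of_mem_gates hg fun v => ⟨fun hv => ?_, fun hv => hv.mono_left hjg⟩).antisymm
        hjg
      -- The cone types of `a` and `b` are those of gs and gt, so `j` and `g` lie in the same part.
      exact hgj.perp cs ((hav v).1 (hv.mono_left hj.left)) ((hbv v).1 (hv.mono_left hj.right))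
    have hlub : IsLUB {(⟨a, ha⟩ : cs.gates), ⟨b, hb⟩} ⟨g, hg⟩ := by
      constructor
      · rintro _ (rfl | rfl)
        exacts [has.trans hsg, hbt.trans htg]
      · intro c hc
        rw [cs.gates_le_iff]
        change cs.WeakLE g c.1
        rw [hj_eq]
        exact hj.le c.1 (hc (Set.mem_insert _ _)) (hc (Set.mem_insert_of_mem _ rfl))
    rcases hirr _ _ hlub with h | h
    · rw [← (Subtype.mk.inj h : g = a)] at has
      exact absurd has.length_le (not_le.2 hs)
    · rw [← (Subtype.mk.inj h : g = b)] at hbt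
      exact absurd hbt.length_le (not_le.2 ht)
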